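/- **Theorem (Turán inequalities for multiple Hermite polynomials).** Let $r\ge 1$ and let $c_1,\dots,c_r$ be pairwise distinct real numbers. For each multi-index $\vec n=(n_1,\dots,n_r)$ of non-negative integers, with $|\vec n|=n_1+\dots+n_r$, there is exactly one monic real polynomial $H_{\vec n}$ of degree $|\vec n|$ (the multiple Hermite polynomial) such that $$\int_{-\infty}^{\infty} x^k H_{\vec n}(x)\,e^{-x^2+c_jx}\,dx=0,\qquad k=0,1,\dots,n_j-1,\quad j=1,\dots,r.$$ These polynomials satisfy, for all multi-indices $\vec n$, all $j,k\in\{1,\dots,r\}$ and all $x\in\mathbb R$, $$H_{\vec n+\vec e_j}(x)\,H_{\vec n+\vec e_k}(x)-H_{\vec n}(x)\,H_{\vec n+\vec e_j+\vec e_k}(x)>0,$$ where $\vec e_i$ denotes the $i$-th standard unit vector. In particular, taking $j=k$, $$H_{\vec n+\vec e_j}(x)^2-H_{\vec n}(x)\,H_{\vec n+2\vec e_j}(x)>0.$$ -/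

import Mathlib

open Polynomial MeasureTheory

/-- `P` is a multiple Hermite polynomial of multi-index `n` for the parameters `c`: it is monic of
degree `|n| = n₁ + ⋯ + n_r`, and for every `j` it is orthogonal to `1, x, …, x ^ (n_j - 1)` with
respect to the weight `exp (-x² + c_j x)` on the real line. -/
def IsMultipleHermite {r : ℕ} (c : Fin r → ℝ) (n : Fin r → ℕ) (P : ℝ[X]) : Prop :=
  P.Monic ∧ P.natDegree = ∑ i, n i ∧
    ∀ j : Fin r, ∀ k : ℕ, k < n j →
      ∫ x : ℝ, x ^ k * P.eval x * Real.exp (-x ^ 2 + c j * x) = 0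

/-- The multiple Hermite polynomial `H_n` for the parameters `c`: the polynomial singled out by
`IsMultipleHermite` (when the `c_j` are distinct there is exactly one). -/
noncomputable def multipleHermite {r : ℕ} (c : Fin r → ℝ) (n : Fin r → ℕ) : ℝ[X] :=
  Classical.epsilon (IsMultipleHermite c n)

/-! ### The operators `X + s D` and the heat transform `exp (s D² / 2)` -/

/-! Integrating a polynomial against `exp (-x² + c x)` gives, up to a positive constant, the value
at `c / 2` of its transform under `exp (D² / 4)`, and this transform turns multiplication by `x`
into `X + D / 2`. Orthogonality to `1, …, x ^ (m - 1)` thus means that the transform vanishes at `c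
/ 2` to order `m` (`orthogonality_iff`). For distinct `c_j`, the degree forces the transform to be
`∏ (X - c_j / 2) ^ n_j`; inverting it gives existence and uniqueness.

Hence `H_{n+e_j} = (X - c_j / 2) H_n - H_n' / 2`, and in the Turán expression all parameters cancel,
leaving `H_n² / 2 + (H_n'² - H_n H_n'') / 4`. The recurrence preserves real-rootedness, so the
Laguerre inequality makes the second term nonnegative; simplicity of the zeros makes the sum
strictly positive. -/

/-- The operator `p ↦ X p + s p'` on real polynomials. -/
noncomputable def raising (s : ℝ) : Module.End ℝ ℝ[X] :=
  LinearMap.mulLeft ℝ (X : ℝ[X]) + s • (derivative : ℝ[X] →ₗ[ℝ] ℝ[X])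

theorem raising_apply (s : ℝ) (p : ℝ[X]) : raising s p = X * p + C s * derivative p := by
  simp [raising, smul_eq_C_mul]

/-- The heat transform `exp (s D² / 2)`, obtained by substituting `X + s D` for `X`. -/
noncomputable def heat (s : ℝ) : ℝ[X] →ₗ[ℝ] ℝ[X] :=
  (LinearMap.applyₗ (1 : ℝ[X])).comp (aeval (raising s)).toLinearMap

theorem heat_apply (s : ℝ) (p : ℝ[X]) : heat s p = aeval (raising s) p 1 := rfl

theorem heat_one (s : ℝ) : heat s 1 = 1 := by simp [heat_apply]

theorem heat_X_mul (s : ℝ) (p : ℝ[X]) : heat s (X * p) = raising s (heat s p) := by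
  simp [heat_apply]

theorem heat_X_pow_mul (s : ℝ) (k : ℕ) (p : ℝ[X]) :
    heat s (X ^ k * p) = (raising s ^ k) (heat s p) := by
  simp [heat_apply]

theorem heat_C_mul (s a : ℝ) (p : ℝ[X]) : heat s (C a * p) = C a * heat s p := by
  rw [← smul_eq_C_mul, ← smul_eq_C_mul, map_smul]

theorem heat_X_sub_C_mul (s a : ℝ) (p : ℝ[X]) :
    heat s ((X - C a) * p) = (X - C a) * heat s p + C s * derivative (heat s p) := by
  rw [sub_mul, map_sub, heat_X_mul, heat_C_mul, raising_apply]
  ring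

/-- Induction principle: a linear property of polynomials that holds at `1` and is stable under
multiplication by `X` holds for all polynomials. -/
theorem polynomial_induction_X_mul {M : ℝ[X] → Prop} (h1 : M 1)
    (hadd : ∀ p q, M p → M q → M (p + q)) (hC : ∀ a p, M p → M (C a * p))
    (hX : ∀ p, M p → M (X * p)) (p : ℝ[X]) : M p := by
  have hpow : ∀ n : ℕ, M (X ^ n) := fun n => by
    induction n with
    | zero => simpa using h1
    | succ n ih => rw [pow_succ']; exact hX _ ih
  induction p using Polynomial.induction_on' with
  | add p q hp hq => exact hadd p q hp hq
  | monomial n a => rw [← C_mul_X_pow_eq_monomial]; exact hC a _ (hpow n)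

theorem heat_derivative (s : ℝ) (p : ℝ[X]) :
    heat s (derivative p) = derivative (heat s p) := by
  induction p using polynomial_induction_X_mul with
  | h1 => simp [heat_one]
  | hadd p q hp hq => simp [hp, hq]
  | hC a p hp => simp [heat_C_mul, hp]
  | hX p hp =>
    simp only [derivative_mul, derivative_X, map_add, heat_X_mul, one_mul, hp, raising_apply,
      derivative_C, zero_mul, zero_add]
    ring

/-- Since the transform commutes with `D`, the term `s D` produced by the first transform cancels
the `-s D` produced by the second. -/
theorem heat_neg_heat (s : ℝ) (p : ℝ[X]) : heat (-s) (heat s p) = p := by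
  induction p using polynomial_induction_X_mul with
  | h1 => simp [heat_one]
  | hadd p q hp hq => simp [hp, hq]
  | hC a p hp => simp [heat_C_mul, hp]
  | hX p hp =>
    rw [heat_X_mul, raising_apply, map_add, heat_X_mul, heat_C_mul, heat_derivative, hp,
      raising_apply, C_neg]
    ring

theorem natDegree_raising_pow_one_le (s : ℝ) (n : ℕ) :
    ((raising s ^ n) (1 : ℝ[X])).natDegree ≤ n := by
  induction n with
  | zero => simp
  | succ n ih =>
    rw [pow_succ', Module.End.mul_apply, raising_apply]
    refine natDegree_add_le_of_degree_le ?_ ?_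
    · refine natDegree_mul_le.trans ?_
      rw [natDegree_X]
      omega
    · refine (natDegree_C_mul_le _ _).trans ((natDegree_derivative_le _).trans ?_)
      omega

theorem natDegree_heat_le (s : ℝ) (p : ℝ[X]) : (heat s p).natDegree ≤ p.natDegree := by
  rw [heat_apply, aeval_eq_sum_range, LinearMap.sum_apply]
  refine natDegree_sum_le_of_forall_le _ _ fun i hi => ?_
  rw [LinearMap.smul_apply]
  refine (natDegree_smul_le _ _).trans ((natDegree_raising_pow_one_le s i).trans ?_)
  simpa [Nat.lt_succ_iff] using hi

/-- `(X - a) p + s p'` is monic of degree one more than `p`. -/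
theorem monic_X_sub_C_mul_add_derivative {p : ℝ[X]} (hp : p.Monic) (s a : ℝ) :
    ((X - C a) * p + C s * derivative p).Monic ∧
      ((X - C a) * p + C s * derivative p).natDegree = p.natDegree + 1 := by
  have hm : ((X - C a) * p).Monic := (monic_X_sub_C a).mul hp
  have hd : ((X - C a) * p).natDegree = p.natDegree + 1 := by
    rw [(monic_X_sub_C a).natDegree_mul hp, natDegree_X_sub_C, add_comm]
  have hlt : (C s * derivative p).natDegree < ((X - C a) * p).natDegree := by
    have := (natDegree_C_mul_le s (derivative p)).trans (natDegree_derivative_le p)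
    omega
  exact ⟨hm.add_of_left (degree_lt_degree hlt),
    by rw [natDegree_add_eq_left_of_natDegree_lt hlt, hd]⟩

/-! ### Vanishing at a point of the iterates of `X + s D` -/

theorem X_sub_C_pow_dvd_raising {s a : ℝ} {m : ℕ} {p : ℝ[X]} (h : (X - C a) ^ (m + 1) ∣ p) :
    (X - C a) ^ m ∣ raising s p := by
  obtain ⟨q, rfl⟩ := h
  rw [raising_apply]
  refine dvd_add (Dvd.dvd.mul_left (Dvd.dvd.mul_right (pow_dvd_pow _ m.le_succ) _) _)
    (Dvd.dvd.mul_left ?_ _)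
  refine (pow_sub_one_dvd_derivative_of_pow_dvd (n := m + 1) (dvd_mul_right _ q))

theorem eval_raising_pow_eq_zero {s a : ℝ} {m k : ℕ} (hk : k < m) {p : ℝ[X]}
    (h : (X - C a) ^ m ∣ p) : ((raising s ^ k) p).eval a = 0 := by
  induction k generalizing m p with
  | zero =>
    have := (dvd_pow_self (X - C a) (by omega : m ≠ 0)).trans h
    simpa using dvd_iff_isRoot.mp this
  | succ k ih =>
    obtain ⟨m, rfl⟩ : ∃ l, m = l + 1 := ⟨m - 1, by omega⟩
    rw [pow_succ, Module.End.mul_apply]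
    exact ih (by omega) (X_sub_C_pow_dvd_raising h)

/-- Only the terms in which each of the `m` derivatives removes a factor `X - a` survive at `a`. -/
theorem eval_raising_pow_X_sub_C_pow_mul (s a : ℝ) (m : ℕ) (p : ℝ[X]) :
    ((raising s ^ m) ((X - C a) ^ m * p)).eval a = s ^ m * m.factorial * p.eval a := by
  induction m generalizing p with
  | zero => simp
  | succ m ih =>
    have : raising s ((X - C a) ^ (m + 1) * p) = (X - C a) ^ m *
        (C (s * (m + 1)) * p + (X - C a) * (X * p + C s * derivative p)) := by
      rw [raising_apply, derivative_mul, derivative_X_sub_C_pow]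
      simp only [Nat.add_sub_cancel, C_mul, C_add, map_natCast, C_1, Nat.cast_add, Nat.cast_one]
      ring
    rw [pow_succ, Module.End.mul_apply, this, ih]
    simp [Nat.factorial_succ]
    ring

theorem forall_eval_raising_pow_eq_zero_iff {s : ℝ} (hs : s ≠ 0) (a : ℝ) (m : ℕ) (p : ℝ[X]) :
    (∀ k < m, ((raising s ^ k) p).eval a = 0) ↔ (X - C a) ^ m ∣ p := by
  refine ⟨fun h => ?_, fun h k hk => eval_raising_pow_eq_zero hk h⟩
  induction m with
  | zero => simp
  | succ m ih =>
    obtain ⟨q, rfl⟩ := ih fun k hk => h k (by omega)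
    have h0 := h m (by omega)
    rw [eval_raising_pow_X_sub_C_pow_mul] at h0
    have hq : q.eval a = 0 := by
      have : s ^ m * (m.factorial : ℝ) ≠ 0 :=
        mul_ne_zero (pow_ne_zero _ hs) (Nat.cast_ne_zero.mpr m.factorial_ne_zero)
      exact (mul_eq_zero.mp h0).resolve_left this
    rw [pow_succ]
    exact mul_dvd_mul_left _ (dvd_iff_isRoot.mpr hq)

/-! ### Gaussian moments -/

theorem integrable_eval_mul_exp_neg_sq (p : ℝ[X]) :
    Integrable fun x : ℝ => p.eval x * Real.exp (-x ^ 2) := by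
  induction p using Polynomial.induction_on' with
  | add p q hp hq =>
    refine (hp.add hq).congr (Filter.Eventually.of_forall fun x => ?_)
    simp [add_mul]
  | monomial n a =>
    have h := (integrable_rpow_mul_exp_neg_mul_sq one_pos
      (s := (n : ℝ)) (by linarith [(Nat.cast_nonneg n : (0 : ℝ) ≤ n)])).const_mul a
    refine h.congr (Filter.Eventually.of_forall fun x => ?_)
    simp [eval_monomial, mul_assoc]

theorem integrable_eval_mul_exp (c : ℝ) (p : ℝ[X]) :
    Integrable fun x : ℝ => p.eval x * Real.exp (-x ^ 2 + c * x) := by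
  -- Completing the square: `-x² + c x = c² / 4 - (x - c / 2)²`.
  have h := ((integrable_eval_mul_exp_neg_sq (p.comp (X + C (c / 2)))).comp_sub_right
    (c / 2)).const_mul (Real.exp (c ^ 2 / 4))
  refine h.congr (Filter.Eventually.of_forall fun x => ?_)
  have : Real.exp (-x ^ 2 + c * x) = Real.exp (c ^ 2 / 4) * Real.exp (-(x - c / 2) ^ 2) := by
    rw [← Real.exp_add]
    ring_nf
  simp only [eval_comp, eval_add, eval_X, eval_C, sub_add_cancel, this]
  ring

/-- Integration by parts: the derivative of `p` times the weight has integral zero. -/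
theorem integral_X_mul_eval_mul_exp (c : ℝ) (p : ℝ[X]) :
    ∫ x : ℝ, (X * p).eval x * Real.exp (-x ^ 2 + c * x) =
      c / 2 * (∫ x : ℝ, p.eval x * Real.exp (-x ^ 2 + c * x)) +
        1 / 2 * ∫ x : ℝ, (derivative p).eval x * Real.exp (-x ^ 2 + c * x) := by
  have hd : ∀ x : ℝ, HasDerivAt (fun x => p.eval x * Real.exp (-x ^ 2 + c * x))
      ((derivative p + (C c - 2 * X) * p).eval x * Real.exp (-x ^ 2 + c * x)) x := fun x => by
    have h1 : HasDerivAt (fun x : ℝ => -x ^ 2 + c * x) (-(2 * x) + c) x := by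
      have h2 := (hasDerivAt_pow 2 x).neg.add ((hasDerivAt_id x).const_mul c)
      simp only [Nat.cast_ofNat, Nat.add_one_sub_one, pow_one, mul_one] at h2
      exact h2
    refine ((p.hasDerivAt x).mul h1.exp).congr_deriv ?_
    simp only [eval_add, eval_mul, eval_sub, eval_C, eval_X, eval_ofNat]
    ring
  have h0 := integral_eq_zero_of_hasDerivAt_of_integrable hd (integrable_eval_mul_exp c _)
    (integrable_eval_mul_exp c p)
  have hs : ∀ x : ℝ, (derivative p + (C c - 2 * X) * p).eval x * Real.exp (-x ^ 2 + c * x) =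
      (derivative p).eval x * Real.exp (-x ^ 2 + c * x) +
        c * (p.eval x * Real.exp (-x ^ 2 + c * x)) -
        2 * ((X * p).eval x * Real.exp (-x ^ 2 + c * x)) := fun x => by
    simp
    ring
  simp_rw [hs] at h0
  rw [integral_sub, integral_add, integral_const_mul, integral_const_mul] at h0
  · linarith
  · exact integrable_eval_mul_exp c _
  · exact (integrable_eval_mul_exp c p).const_mul c
  · exact (integrable_eval_mul_exp c _).add ((integrable_eval_mul_exp c p).const_mul c)
  · exact (integrable_eval_mul_exp c _).const_mul 2

/-- The Laplace transform of a polynomial times a Gaussian is the heat transform of the polynomial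
times a Gaussian. -/
theorem integral_eval_mul_exp (c : ℝ) (p : ℝ[X]) :
    ∫ x : ℝ, p.eval x * Real.exp (-x ^ 2 + c * x) =
      (heat (1 / 2) p).eval (c / 2) * ∫ x : ℝ, Real.exp (-x ^ 2 + c * x) := by
  have hadd : ∀ p q : ℝ[X], ∫ x : ℝ, (p + q).eval x * Real.exp (-x ^ 2 + c * x) =
      (∫ x : ℝ, p.eval x * Real.exp (-x ^ 2 + c * x)) +
        ∫ x : ℝ, q.eval x * Real.exp (-x ^ 2 + c * x) := fun p q => by
    rw [← integral_add (integrable_eval_mul_exp c p) (integrable_eval_mul_exp c q)]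
    simp [add_mul]
  have hmul : ∀ (a : ℝ) (p : ℝ[X]), ∫ x : ℝ, (C a * p).eval x * Real.exp (-x ^ 2 + c * x) =
      a * ∫ x : ℝ, p.eval x * Real.exp (-x ^ 2 + c * x) := fun a p => by
    rw [← integral_const_mul]
    simp [mul_assoc]
  have hpow : ∀ n : ℕ, ∫ x : ℝ, ((X : ℝ[X]) ^ n).eval x * Real.exp (-x ^ 2 + c * x) =
      (heat (1 / 2) (X ^ n)).eval (c / 2) * ∫ x : ℝ, Real.exp (-x ^ 2 + c * x) := fun n => by
    induction n using Nat.strong_induction_on with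
    | _ n ih =>
      cases n with
      | zero => simp [heat_one]
      | succ n =>
        -- The derivative brings in exponent `n - 1`, hence the strong induction; at `n = 0` its
        -- coefficient vanishes, so truncated subtraction is harmless.
        rw [pow_succ', integral_X_mul_eval_mul_exp, heat_X_mul, raising_apply, ← heat_derivative,
          derivative_X_pow, hmul, ih n (by omega), ih (n - 1) (by omega), heat_C_mul]
        simp only [eval_add, eval_mul, eval_C, eval_X]
        ring
  induction p using Polynomial.induction_on' with
  | add p q hp hq => rw [hadd, hp, hq, map_add, eval_add, add_mul]
  | monomial n a =>
    rw [← C_mul_X_pow_eq_monomial, hmul, hpow, heat_C_mul, eval_mul, eval_C, mul_assoc]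

theorem integral_exp_neg_sq_add_mul_pos (c : ℝ) : 0 < ∫ x : ℝ, Real.exp (-x ^ 2 + c * x) :=
  integral_exp_pos (by simpa using integrable_eval_mul_exp c 1)

/-! ### Existence and uniqueness -/

theorem orthogonality_iff (c : ℝ) (m : ℕ) (p : ℝ[X]) :
    (∀ k < m, ∫ x : ℝ, x ^ k * p.eval x * Real.exp (-x ^ 2 + c * x) = 0) ↔
      (X - C (c / 2)) ^ m ∣ heat (1 / 2) p := by
  rw [← forall_eval_raising_pow_eq_zero_iff (by norm_num : (1 / 2 : ℝ) ≠ 0)]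
  refine forall₂_congr fun k _ => ?_
  have := integral_eval_mul_exp c (X ^ k * p)
  simp only [eval_mul, eval_pow, eval_X] at this
  rw [this, heat_X_pow_mul, mul_eq_zero, or_iff_left (integral_exp_neg_sq_add_mul_pos c).ne']

/-- The multiple Hermite polynomial as the backward heat transform of `∏ (X - c_j / 2) ^ n_j`. -/
noncomputable def hermiteHeat {r : ℕ} (c : Fin r → ℝ) (n : Fin r → ℕ) : ℝ[X] :=
  heat (-(1 / 2)) (∏ i, (X - C (c i / 2)) ^ n i)

theorem hermiteHeat_zero {r : ℕ} (c : Fin r → ℝ) : hermiteHeat c 0 = 1 := by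
  simp [hermiteHeat, heat_one]

theorem hermiteHeat_add_single {r : ℕ} (c : Fin r → ℝ) (n : Fin r → ℕ) (j : Fin r) :
    hermiteHeat c (n + Pi.single j 1) =
      (X - C (c j / 2)) * hermiteHeat c n + C (-(1 / 2)) * derivative (hermiteHeat c n) := by
  have : ∏ i, (X - C (c i / 2)) ^ (n + Pi.single j 1 : Fin r → ℕ) i =
      (X - C (c j / 2)) * ∏ i, (X - C (c i / 2)) ^ n i := by
    simp only [Pi.add_apply, pow_add, Finset.prod_mul_distrib]
    rw [mul_comm, Finset.prod_eq_single j]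
    · simp
    · intro b _ hb
      simp [hb]
    · simp
  rw [hermiteHeat, this, heat_X_sub_C_mul]
  rfl

/-- Induction over multi-indices by adding unit vectors. -/
theorem multiIndex_induction {r : ℕ} {M : (Fin r → ℕ) → Prop} (h0 : M 0)
    (hs : ∀ n j, M n → M (n + Pi.single j 1)) (n : Fin r → ℕ) : M n := by
  induction hN : ∑ i, n i generalizing n with
  | zero =>
    have : n = 0 := by
      ext i
      exact Finset.sum_eq_zero_iff.mp hN i (Finset.mem_univ i)
    rwa [this]
  | succ N ih =>
    obtain ⟨j, -, hj⟩ : ∃ j ∈ Finset.univ, n j ≠ 0 :=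
      Finset.exists_ne_zero_of_sum_ne_zero (by omega)
    have hn : n - Pi.single j 1 + Pi.single j 1 = n := by
      ext i
      by_cases h : i = j
      · subst h
        simp
        omega
      · simp [h]
    rw [← hn]
    refine hs _ _ (ih _ ?_)
    rw [← hn] at hN
    simp only [Pi.add_apply, Finset.sum_add_distrib, Finset.sum_pi_single', Finset.mem_univ,
      if_true] at hN
    simpa using hN

theorem monic_hermiteHeat {r : ℕ} (c : Fin r → ℝ) (n : Fin r → ℕ) :
    (hermiteHeat c n).Monic ∧ (hermiteHeat c n).natDegree = ∑ i, n i := by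
  induction n using multiIndex_induction with
  | h0 => simp [hermiteHeat_zero]
  | hs n j ih =>
    have := monic_X_sub_C_mul_add_derivative ih.1 (-(1 / 2)) (c j / 2)
    rw [← hermiteHeat_add_single, ih.2] at this
    refine ⟨this.1, ?_⟩
    rw [this.2]
    simp [Finset.sum_add_distrib]

theorem heat_hermiteHeat {r : ℕ} (c : Fin r → ℝ) (n : Fin r → ℕ) :
    heat (1 / 2) (hermiteHeat c n) = ∏ i, (X - C (c i / 2)) ^ n i := by
  simpa [hermiteHeat] using heat_neg_heat (-(1 / 2)) (∏ i, (X - C (c i / 2)) ^ n i)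

theorem isMultipleHermite_hermiteHeat {r : ℕ} (c : Fin r → ℝ) (n : Fin r → ℕ) :
    IsMultipleHermite c n (hermiteHeat c n) := by
  refine ⟨(monic_hermiteHeat c n).1, (monic_hermiteHeat c n).2, fun j => ?_⟩
  rw [orthogonality_iff, heat_hermiteHeat]
  exact Finset.dvd_prod_of_mem (fun i => (X - C (c i / 2)) ^ n i) (Finset.mem_univ j)

theorem IsMultipleHermite.eq_hermiteHeat {r : ℕ} {c : Fin r → ℝ} (hc : Function.Injective c)
    {n : Fin r → ℕ} {P : ℝ[X]} (hP : IsMultipleHermite c n P) : P = hermiteHeat c n := by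
  obtain ⟨hm, hd, ho⟩ := hP
  have hdvd : ∏ i, (X - C (c i / 2)) ^ n i ∣ heat (1 / 2) P := by
    refine Finset.prod_dvd_of_coprime (fun i _ j _ hij => ?_)
      fun j _ => (orthogonality_iff (c j) (n j) P).mp (ho j)
    refine IsCoprime.pow (pairwise_coprime_X_sub_C (s := fun i => c i / 2) ?_ hij)
    exact fun i j h => hc (by simpa using h)
  have hW : (∏ i, (X - C (c i / 2)) ^ n i).Monic :=
    monic_prod_of_monic _ _ fun i _ => (monic_X_sub_C _).pow _
  have hWd : (∏ i, (X - C (c i / 2)) ^ n i).natDegree = ∑ i, n i := by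
    rw [natDegree_prod_of_monic _ _ fun i _ => (monic_X_sub_C _).pow _]
    simp
  obtain ⟨q, hq⟩ := hdvd
  have hP0 : P = heat (-(1 / 2)) (heat (1 / 2) P) := (heat_neg_heat _ _).symm
  have hq0 : q ≠ 0 := by
    rintro rfl
    rw [hq, mul_zero, map_zero] at hP0
    exact hm.ne_zero hP0
  -- The product already has degree `|n|`, and `heat` does not raise degrees.
  have hqd : q.natDegree = 0 := by
    have h1 := natDegree_heat_le (1 / 2) P
    rw [hq, hW.natDegree_mul' hq0, hWd, hd] at h1
    omega
  obtain ⟨a, rfl⟩ := natDegree_eq_zero.mp hqd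
  rw [hq, mul_comm, heat_C_mul] at hP0
  change P = C a * hermiteHeat c n at hP0
  have ha : a = 1 := by
    have := congrArg leadingCoeff hP0
    rw [leadingCoeff_mul, leadingCoeff_C, hm.leadingCoeff,
      (monic_hermiteHeat c n).1.leadingCoeff] at this
    linarith
  rw [hP0, ha, C_1, one_mul]

theorem multipleHermite_eq_hermiteHeat {r : ℕ} {c : Fin r → ℝ} (hc : Function.Injective c)
    (n : Fin r → ℕ) : multipleHermite c n = hermiteHeat c n :=
  IsMultipleHermite.eq_hermiteHeat hc
    (Classical.epsilon_spec (p := IsMultipleHermite c n) ⟨_, isMultipleHermite_hermiteHeat c n⟩)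

/-! ### Real-rooted polynomials -/

theorem monic_splits_induction {M : ℝ[X] → Prop} (h1 : M 1)
    (hmul : ∀ a p, M p → M ((X - C a) * p)) {p : ℝ[X]} (hp : p.Splits) (hm : p.Monic) : M p := by
  rw [hp.eq_prod_roots_of_monic hm]
  induction p.roots using Multiset.induction_on with
  | empty => simpa using h1
  | cons a s ih => simpa using hmul a _ ih

/-- The Laguerre inequality. -/
theorem laguerre_inequality {p : ℝ[X]} (hp : p.Splits) (hm : p.Monic) (x : ℝ) :
    0 ≤ (derivative p).eval x ^ 2 - p.eval x * (derivative (derivative p)).eval x := by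
  refine monic_splits_induction (M := fun p => 0 ≤ (derivative p).eval x ^ 2 -
    p.eval x * (derivative (derivative p)).eval x) ?_ (fun a p ih => ?_) hp hm
  · simp
  -- A new root turns the Laguerre expression `L` into `p² + (x - a)² L`.
  · have : (derivative ((X - C a) * p)).eval x ^ 2 -
        ((X - C a) * p).eval x * (derivative (derivative ((X - C a) * p))).eval x =
        p.eval x ^ 2 + (x - a) ^ 2 * ((derivative p).eval x ^ 2 -
          p.eval x * (derivative (derivative p)).eval x) := by
      simp
      ring
    rw [this]
    positivity

/-- The logarithmic derivative of a real-rooted polynomial maps the upper half plane to the lower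
half plane, and conversely. -/
theorem im_mul_im_derivative_mul_conj_nonpos {p : ℝ[X]} (hp : p.Splits) (hm : p.Monic) (z : ℂ) :
    z.im * (aeval z (derivative p) * (starRingEnd ℂ) (aeval z p)).im ≤ 0 := by
  refine monic_splits_induction (M := fun p => z.im *
    (aeval z (derivative p) * (starRingEnd ℂ) (aeval z p)).im ≤ 0) ?_ (fun a p ih => ?_) hp hm
  · simp
  -- This is the rule that a factor `X - a` adds `1 / (z - a)` to `p' / p`, cleared of denominators.
  · have : aeval z (derivative ((X - C a) * p)) * (starRingEnd ℂ) (aeval z ((X - C a) * p)) =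
        (Complex.normSq (aeval z p) : ℂ) * (starRingEnd ℂ) (z - a) +
        (Complex.normSq (z - a) : ℂ) * (aeval z (derivative p) * (starRingEnd ℂ) (aeval z p)) := by
      rw [← Complex.mul_conj, ← Complex.mul_conj]
      simp
      ring
    rw [this, Complex.add_im, Complex.im_ofReal_mul, Complex.im_ofReal_mul]
    have h1 : ((starRingEnd ℂ) (z - a)).im = -z.im := by simp
    rw [h1]
    nlinarith [mul_nonneg (Complex.normSq_nonneg (aeval z p)) (mul_self_nonneg z.im),
      mul_nonpos_of_nonneg_of_nonpos (Complex.normSq_nonneg (z - a)) ih]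

/-- At a nonreal root `z`, `p' / p = 2 (z - a)` would have imaginary part of the same sign as that
of `z`, which real-rootedness of `p` forbids. -/
theorem splits_X_sub_C_mul_sub_derivative {p : ℝ[X]} (hp : p.Splits) (hm : p.Monic) (a : ℝ) :
    ((X - C a) * p + C (-(1 / 2)) * derivative p).Splits := by
  refine Splits.of_splits_map_of_injective (i := algebraMap ℝ ℂ) (algebraMap ℝ ℂ).injective
    (IsAlgClosed.splits _) fun z hz => ?_
  have hz0 : aeval z ((X - C a) * p + C (-(1 / 2)) * derivative p) = 0 := by
    have := isRoot_of_mem_roots hz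
    rwa [IsRoot, eval_map_algebraMap] at this
  suffices him : z.im = 0 from ⟨z.re, Complex.ext (by simp) (by simp [him])⟩
  by_contra him
  have hpz : aeval z p ≠ 0 := fun h => by
    obtain ⟨y, hy⟩ := hp.mem_range_of_isRoot (i := algebraMap ℝ ℂ) hm.ne_zero (x := z)
      (by rwa [IsRoot, eval_map_algebraMap])
    exact him (by rw [← hy]; simp)
  have hd : aeval z (derivative p) = 2 * (z - a) * aeval z p := by
    simp at hz0
    linear_combination (-2) * hz0
  have := im_mul_im_derivative_mul_conj_nonpos hp hm z
  rw [hd, mul_assoc, Complex.mul_conj, Complex.im_mul_ofReal] at this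
  have h1 : (2 * (z - a) : ℂ).im = 2 * z.im := by simp
  rw [h1] at this
  have h2 : 0 < z.im * z.im * Complex.normSq (aeval z p) :=
    mul_pos (mul_self_pos.mpr him) (Complex.normSq_pos.mpr hpz)
  nlinarith

/-- Multiple Hermite polynomials have only real zeros, and these are simple. -/
theorem hermiteHeat_splits_and_simple {r : ℕ} (c : Fin r → ℝ) (n : Fin r → ℕ) :
    (hermiteHeat c n).Splits ∧ ∀ x, (hermiteHeat c n).eval x = 0 →
      (derivative (hermiteHeat c n)).eval x ≠ 0 := by
  induction n using multiIndex_induction with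
  | h0 => simp [hermiteHeat_zero]
  | hs n j ih =>
    have hm := (monic_hermiteHeat c n).1
    rw [hermiteHeat_add_single]
    refine ⟨splits_X_sub_C_mul_sub_derivative ih.1 hm _, fun x h0 h1 => ?_⟩
    have hL := laguerre_inequality ih.1 hm x
    simp at h0 h1
    -- Eliminating `x - c_j / 2` from the two equations of a double zero leaves a sum of nonnegative
    -- terms, so `H_n`, and then `H_n'`, vanish at `x`.
    have hsq : (hermiteHeat c n).eval x ^ 2 + ((derivative (hermiteHeat c n)).eval x ^ 2 -
        (hermiteHeat c n).eval x * (derivative (derivative (hermiteHeat c n))).eval x) / 2 = 0 := by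
      linear_combination (hermiteHeat c n).eval x * h1 - (derivative (hermiteHeat c n)).eval x * h0
    have hz : (hermiteHeat c n).eval x = 0 := by
      refine pow_eq_zero_iff two_ne_zero |>.mp (le_antisymm ?_ (sq_nonneg _))
      linarith
    refine ih.2 x hz ?_
    rw [hz] at h0
    linarith

/-! ### The Turán inequality -/

theorem hermiteHeat_turan {r : ℕ} (c : Fin r → ℝ) (n : Fin r → ℕ) (j k : Fin r) (x : ℝ) :
    0 < (hermiteHeat c (n + Pi.single j 1)).eval x * (hermiteHeat c (n + Pi.single k 1)).eval x -
      (hermiteHeat c n).eval x *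
        (hermiteHeat c (n + Pi.single j 1 + Pi.single k 1)).eval x := by
  obtain ⟨hs, hsimple⟩ := hermiteHeat_splits_and_simple c n
  have hL := laguerre_inequality hs (monic_hermiteHeat c n).1 x
  have hid : (hermiteHeat c (n + Pi.single j 1)).eval x *
        (hermiteHeat c (n + Pi.single k 1)).eval x -
      (hermiteHeat c n).eval x * (hermiteHeat c (n + Pi.single j 1 + Pi.single k 1)).eval x =
      (hermiteHeat c n).eval x ^ 2 / 2 + ((derivative (hermiteHeat c n)).eval x ^ 2 -
        (hermiteHeat c n).eval x * (derivative (derivative (hermiteHeat c n))).eval x) / 4 := by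
    rw [hermiteHeat_add_single c (n + Pi.single j 1), hermiteHeat_add_single,
      hermiteHeat_add_single c n k]
    simp
    ring
  rw [hid]
  by_cases hz : (hermiteHeat c n).eval x = 0
  · have := pow_pos (abs_pos.mpr (hsimple x hz)) 2
    rw [sq_abs] at this
    rw [hz]
    linarith
  · have := pow_pos (abs_pos.mpr hz) 2
    rw [sq_abs] at this
    linarith

theorem theorem4p1 {r : ℕ} (c : Fin r → ℝ) (hc : Function.Injective c) :
    (∀ n : Fin r → ℕ,
      IsMultipleHermite c n (multipleHermite c n) ∧
        ∀ P : ℝ[X], IsMultipleHermite c n P → P = multipleHermite c n) ∧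
    (∀ (n : Fin r → ℕ) (j k : Fin r) (x : ℝ),
      0 < (multipleHermite c (n + Pi.single j 1)).eval x *
            (multipleHermite c (n + Pi.single k 1)).eval x -
          (multipleHermite c n).eval x *
            (multipleHermite c (n + Pi.single j 1 + Pi.single k 1)).eval x) ∧
    (∀ (n : Fin r → ℕ) (j : Fin r) (x : ℝ),
      0 < (multipleHermite c (n + Pi.single j 1)).eval x ^ 2 -
          (multipleHermite c n).eval x *
            (multipleHermite c (n + 2 • Pi.single j 1)).eval x) := by
  simp only [multipleHermite_eq_hermiteHeat hc]
  refine ⟨fun n => ⟨isMultipleHermite_hermiteHeat c n, fun P hP => hP.eq_hermiteHeat hc⟩,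
    hermiteHeat_turan c, fun n j x => ?_⟩
  rw [two_nsmul, ← add_assoc, sq]
  exact hermiteHeat_turan c n j j x
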